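/- Let $\kappa$ be a regular (in particular infinite) cardinal, identified with its initial ordinal. For an ordinal $\alpha$, a record of length $\alpha$ is a sequence $r=(r(\beta))_{\beta<\alpha}$ in $\{0,1\}$ such that for every limit ordinal $\lambda\le\alpha$ there is $\gamma<\lambda$ with $r(\beta)=0$ whenever $\gamma\le\beta<\lambda$ (here $0$ is not a limit ordinal); the least such $\gamma$ is denoted $o^\lambda(r)$. An ordinal is even or odd according to the parity of $n$ when it is written as $\hat\lambda+n$ with $\hat\lambda$ zero or a limit ordinal and $n\in\mathbb N$, and the $\lambda$-parity $\lambda\text{-par}(r)\in\{\text{even},\text{odd}\}$ of $r$ is the parity of $o^\lambda(r)$. Let $W^\alpha$ be the set of all triples $w=(w_0,w_a,w_b)$ with $w_0\in\{h,t\}$ and $w_a,w_b$ records of length $\alpha$; $W^0$ is identified with $\{h,t\}$. For $\beta\le\alpha$ and $w\in W^\alpha$ let $w\restriction\beta\in W^\beta$ be obtained by restricting both records to $\beta$, and let $\pi_{\beta,\alpha}(w)=w\restriction\beta$. For $i\in\{a,b\}$ let $j$ be the other element of $\{a,b\}$. For $w\in W^\kappa$ let $P_i(w)$ be the set of all $v\in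 W^\kappa$ such that $v_i=w_i$; if $w_i(0)=1$ then $v_0=w_0$; for every $\beta<\kappa$, if $w_i(\beta+1)=1$ then $v_j(\beta)=w_j(\beta)$; and for every limit ordinal $\lambda<\kappa$, if $w_i(\lambda)=1$ then $\lambda\text{-par}(v_j)=\lambda\text{-par}(w_j)$. Let $\Delta$ be the set of finitely additive probability measures defined on all subsets of $W^\kappa$. **Theorem 2.** For each $i\in\{a,b\}$ (with $j$ the other element of $\{a,b\}$) there is a function $T_i:W^\kappa\to\Delta$ such that, for all $w\in W^\kappa$: (a) $T_i(u)=T_i(w)$ for all $u\in P_i(w)$; (b) $T_i(w)(P_i(w))=1$; (c) $T_i(w)(\{u\in W^\kappa: u_0=w_0\})$ is $1$ if $w_i(0)=1$ and $\tfrac12$ if $w_i(0)=0$; (d) for every $\beta<\kappa$, $T_i(w)(\{u\in W^\kappa: u_j(\beta)=w_j(\beta)\})$ is $1$ if $w_i(\beta+1)=1$ and $\tfrac12$ if $w_i(\beta+1)=0$; (e) for every limit ordinal $\lambda<\kappa$, $T_i(w)(\{u\in W^\kappa:\lambda\text{-par}(u_j)=\lambda\text{-par}(w_j)\})$ is $1$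 if $w_i(\lambda)=1$ and $\tfrac12$ if $w_i(\lambda)=0$; (f) for all ordinals $0\le\beta<\alpha<\kappa$, all $u\in W^\kappa$ with $u\restriction\alpha=w\restriction\alpha$ and all $E\subseteq W^\beta$, $T_i(u)(\pi_{\beta,\kappa}^{-1}(E))=T_i(w)(\pi_{\beta,\kappa}^{-1}(E))$. -/

import Mathlib

universe u

noncomputable section

namespace CoinRecords

/-- The two outcomes of tossing the coin, heads and tails (the states of nature). -/
inductive Coin
  | h
  | t

/-- The two players. -/
inductive Player
  | a
  | b

/-- The other player: the `j` with `{i, j} = {a, b}`. -/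
def Player.other : Player → Player
  | .a => .b
  | .b => .a

/-- A finitely additive probability measure on `(M, Pow M)`. -/
structure FinAddProb (M : Type*) where
  toFun : Set M → ℝ
  nonneg : ∀ E, 0 ≤ toFun E
  union_add : ∀ E F, Disjoint E F → toFun (E ∪ F) = toFun E + toFun F
  univ_eq_one : toFun Set.univ = 1

instance (M : Type*) : CoeFun (FinAddProb M) fun _ => Set M → ℝ := ⟨FinAddProb.toFun⟩

/-- The parity of an ordinal, one of "even" and "odd". -/
inductive Parity
  | even
  | odd

/-- The ordinal `γ` is even: `γ = l + n` where `l` is `0` or a limit ordinal and `n` is an even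
natural number. -/
def IsEvenOrdinal (γ : Ordinal.{u}) : Prop :=
  ∃ (l : Ordinal.{u}) (n : ℕ), (l = 0 ∨ Order.IsSuccLimit l) ∧ γ = l + (n : Ordinal.{u}) ∧ Even n

open scoped Classical in
/-- The parity of an ordinal. -/
def ordinalParity (γ : Ordinal.{u}) : Parity :=
  if IsEvenOrdinal γ then .even else .odd

/-- A record of length `α`: a sequence `(r(β))_{β < α}` of zeros and ones such that below every
limit ordinal `l ≤ α` it is eventually `0`.  The limit ordinals are those satisfying
`Order.IsSuccLimit` (`0` is not one of them).  There is exactly one record of length `0`, the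
empty sequence. -/
@[ext]
structure Record (α : Ordinal.{u}) where
  bit : Set.Iio α → Fin 2
  eventually_zero : ∀ (l : Ordinal.{u}) (hl : l ≤ α), Order.IsSuccLimit l →
    ∃ γ < l, ∀ (β : Ordinal.{u}) (hβ : β < l), γ ≤ β → bit ⟨β, hβ.trans_le hl⟩ = 0

/-- The restriction of a record of length `α` to a record of length `β ≤ α`. -/
def Record.restrict {α : Ordinal.{u}} (r : Record α) (β : Ordinal.{u}) (h : β ≤ α) : Record β where
  bit ξ := r.bit ⟨ξ.1, lt_of_lt_of_le ξ.2 h⟩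
  eventually_zero l hl hlim := r.eventually_zero l (hl.trans h) hlim

/-- For a limit ordinal `l ≤ α`, the least ordinal `o < l` such that `r(β) = 0` for all `β`
with `o ≤ β < l`; it exists by the definition of a record. -/
def Record.lastZero {α : Ordinal.{u}} (r : Record α) (l : Ordinal.{u}) (hl : l ≤ α) :
    Ordinal.{u} :=
  sInf {o | o < l ∧ ∀ (β : Ordinal.{u}) (hβ : β < l), o ≤ β → r.bit ⟨β, hβ.trans_le hl⟩ = 0}

/-- The `l`-parity of a record of length `α`, for a limit ordinal `l ≤ α`. -/
def Record.par {α : Ordinal.{u}} (r : Record α) (l : Ordinal.{u}) (hl : l ≤ α) : Parity :=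
  ordinalParity (r.lastZero l hl)

/-- The space `W^α` of the states `(w_0, w_a, w_b)`: a coin outcome and a record of length `α` for
each player.  As the record of length `0` is unique, `W 0` is the two-point set of coin outcomes. -/
@[ext]
structure W (α : Ordinal.{u}) where
  coin : Coin
  record : Player → Record α

/-- The projection `π_{β,α} : W^α → W^β`, `w ↦ w ↾ β`, for `β ≤ α`. -/
def W.restrict {α : Ordinal.{u}} (w : W α) (β : Ordinal.{u}) (h : β ≤ α) : W β where
  coin := w.coin
  record i := (w.record i).restrict β h

/-- The cell `P_i(w)` of player `i`'s partition of `W^α` (for `α > 0`) that contains `w`. -/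
def cell {α : Ordinal.{u}} (i : Player) (w : W α) : Set (W α) :=
  {v | v.record i = w.record i ∧
    (∀ h0 : 0 < α, (w.record i).bit ⟨0, h0⟩ = 1 → v.coin = w.coin) ∧
    (∀ (β : Ordinal.{u}) (hβ : β + 1 < α), (w.record i).bit ⟨β + 1, hβ⟩ = 1 →
      (v.record i.other).bit ⟨β, (Order.lt_succ β).trans hβ⟩ =
        (w.record i.other).bit ⟨β, (Order.lt_succ β).trans hβ⟩) ∧
    (∀ (l : Ordinal.{u}) (hl : l < α), Order.IsSuccLimit l → (w.record i).bit ⟨l, hl⟩ = 1 →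
      (v.record i.other).par l hl.le = (w.record i.other).par l hl.le)}

/-- The event `[X_0 = c]`. -/
def coinEvent (α : Ordinal.{u}) (c : Coin) : Set (W α) :=
  {v | v.coin = c}

/-- The event `[X_i(β) = x]`, for `β < α`. -/
def bitEvent {α : Ordinal.{u}} (i : Player) (β : Ordinal.{u}) (hβ : β < α) (x : Fin 2) :
    Set (W α) :=
  {v | (v.record i).bit ⟨β, hβ⟩ = x}

/-- The event `[l-par(X_i) = p]`, for a limit ordinal `l ≤ α`. -/
def parEvent {α : Ordinal.{u}} (i : Player) (l : Ordinal.{u}) (hl : l ≤ α) (p : Parity) :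
    Set (W α) :=
  {v | (v.record i).par l hl = p}

theorem ord_pos {κ : Cardinal.{u}} (hκ : κ.IsRegular) : 0 < κ.ord :=
  hκ.ord_pos

theorem add_one_lt_ord {κ : Cardinal.{u}} (hκ : κ.IsRegular) {β : Ordinal.{u}} (hβ : β < κ.ord) :
    β + 1 < κ.ord :=
  (Cardinal.isSuccLimit_ord hκ.aleph0_le).succ_lt hβ

end CoinRecords

end

open CoinRecords

/-!
The support of a record of length `α` is finite: were it infinite, it would accumulate at some limit
ordinal `l ≤ α`.  Conversely every finite set of ordinals below `α` is the support of one.  Hence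
player `i` is informed of only finitely many facts about the other player `j` and the coin.  The facts are
indexed by ordinals: `0` for the coin, `β + 1` for the bit `w_j(β)`, and a limit ordinal `l` for the
`l`-parity of `w_j`; `W.signal` is their common name.

Let `G` be a finite set of ordinals, and prescribe the signals indexed by `G` arbitrarily.  Some
record realizes them all: put the bits prescribed at successors, and for every limit ordinal `l ∈ G`
one further `1` at `marker G x l < l`, beyond all elements of `G` below `l`.  This is the last `1`
below `l`, and moving it by one step adjusts the `l`-parity (`par_ofFinite_realization`), while it
never falls on a bit prescribed by `G`.

Given `w`, a truth value `y` and a finite set `F`, let `w.completion i y F` be the state with the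
record of player `i` unchanged in which the signals that `i` knows are as in `w` and the unknown ones
indexed by `F` are all equal to `y`.  Fix an ultrafilter on the finite sets of ordinals that contains
every `{F | c ∈ F}`.  Pushing it forward along `F ↦ w.completion i y F` and averaging over the two
values of `y` gives `T_i(w)`.  Every completion lies in the cell of `w` and depends on that cell
only; each signal is eventually in `F`, so that it has its known value, or, if it is unknown, each
of its two values with weight one half.  The statement concerns the signals one at a time, so
no independence between different signals is needed.

Finally, the marker of `l` depends on information at `l`.  But as soon as `β ∈ F`, the markers of all
`l > β` are at least `β`, so that the restriction of the completion to `β` depends only on the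
information up to `β` (`W.restrict_completion_congr`).  Locality of `T_i` thus holds
in the limit along the ultrafilter.
-/

noncomputable section

namespace CoinRecords

open Order Filter
open scoped Classical

variable {α : Ordinal.{u}}

/-! ### Parity of ordinals -/

theorem isEvenOrdinal_omega0_mul_add (q : Ordinal.{u}) (n : ℕ) :
    IsEvenOrdinal (Ordinal.omega0 * q + n) ↔ Even n := by
  constructor
  · rintro ⟨l, m, hl, h, hm⟩
    have hd : Ordinal.omega0 ∣ l := by
      rcases hl with rfl | hl
      · exact dvd_zero _
      · exact Ordinal.isSuccPrelimit_iff_omega0_dvd.1 hl.isSuccPrelimit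
    obtain ⟨k, rfl⟩ := hd
    have h' := congrArg (· % Ordinal.omega0) h
    simp only [Ordinal.mul_add_mod_self, Ordinal.mod_eq_of_lt (Ordinal.natCast_lt_omega0 _)] at h'
    rwa [Nat.cast_inj.1 h']
  · intro hn
    refine ⟨_, n, ?_, rfl, hn⟩
    rcases eq_or_ne (Ordinal.omega0 * q) 0 with h | h
    · exact .inl h
    · exact .inr (Ordinal.isSuccLimit_iff.2
        ⟨h, Ordinal.isSuccPrelimit_iff_omega0_dvd.2 (dvd_mul_right _ _)⟩)

theorem isEvenOrdinal_add_one_iff (γ : Ordinal.{u}) :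
    IsEvenOrdinal (γ + 1) ↔ ¬ IsEvenOrdinal γ := by
  obtain ⟨n, hn⟩ := Ordinal.lt_omega0.1 (Ordinal.mod_lt γ Ordinal.omega0_ne_zero)
  have hγ : γ = Ordinal.omega0 * (γ / Ordinal.omega0) + n := by
    rw [← hn, Ordinal.div_add_mod]
  have hγ' : γ + 1 = Ordinal.omega0 * (γ / Ordinal.omega0) + (n + 1 : ℕ) := by
    rw [Nat.cast_add, Nat.cast_one, ← add_assoc, ← hγ]
  rw [hγ', isEvenOrdinal_omega0_mul_add, Nat.even_add_one, ← isEvenOrdinal_omega0_mul_add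
    (γ / Ordinal.omega0), ← hγ]

theorem ordinalParity_eq_even_iff (γ : Ordinal.{u}) :
    ordinalParity γ = .even ↔ IsEvenOrdinal γ := by
  unfold ordinalParity
  split_ifs with h <;> simp [h]

/-! ### Records and finite sets of ordinals -/

/-- The set of the `β < α` at which the record `r` has a `1`. -/
def Record.support (r : Record α) : Set Ordinal.{u} :=
  {β | ∃ h : β < α, r.bit ⟨β, h⟩ = 1}

theorem Record.mem_support_iff (r : Record α) {β : Ordinal.{u}} (h : β < α) :
    β ∈ r.support ↔ r.bit ⟨β, h⟩ = 1 :=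
  ⟨fun ⟨_, h'⟩ => h', fun h' => ⟨h, h'⟩⟩

theorem fin_two_ne_one_iff (x : Fin 2) : x ≠ 1 ↔ x = 0 := by
  omega

theorem fin_two_eq_iff (x y : Fin 2) : x = y ↔ (x = 1 ↔ y = 1) := by
  omega

theorem Record.ext_support {r s : Record α} (h : r.support = s.support) : r = s := by
  refine Record.ext (funext fun ξ => (fin_two_eq_iff _ _).2 ?_)
  rw [← r.mem_support_iff ξ.2, h, s.mem_support_iff ξ.2]

theorem Record.mem_support_restrict (r : Record α) {β : Ordinal.{u}} (h : β ≤ α)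
    {ξ : Ordinal.{u}} : ξ ∈ (r.restrict β h).support ↔ ξ < β ∧ ξ ∈ r.support :=
  ⟨fun ⟨hξ, h1⟩ => ⟨hξ, hξ.trans_le h, h1⟩, fun ⟨hξ, _, h1⟩ => ⟨hξ, h1⟩⟩

theorem Record.finite_support (r : Record α) : r.support.Finite := by
  have key : ∀ l : Ordinal.{u}, l ≤ α → {β ∈ r.support | β < l}.Finite := by
    intro l
    induction l using Ordinal.limitRecOn with
    | zero => intro _; simp
    | add_one l ih =>
      intro hl
      refine ((ih ((lt_succ l).le.trans hl)).insert l).subset ?_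
      rintro β ⟨h1, h2⟩
      rcases (lt_succ_iff.1 h2).eq_or_lt with rfl | h
      · exact .inl rfl
      · exact .inr ⟨h1, h⟩
    | limit l hlim ih =>
      intro hl
      obtain ⟨γ, hγ, h0⟩ := r.eventually_zero l hl hlim
      refine (ih γ hγ (hγ.le.trans hl)).subset ?_
      rintro β ⟨⟨hβ, h1⟩, h2⟩
      refine ⟨⟨hβ, h1⟩, lt_of_not_ge fun h => ?_⟩
      rw [h0 β h2 h] at h1
      exact absurd h1 (by decide)
  refine (key α le_rfl).subset ?_
  rintro β ⟨hβ, h1⟩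
  exact ⟨⟨hβ, h1⟩, hβ⟩

/-- The record of length `α` whose ones are at the elements of the finite set `S` below `α`. -/
def Record.ofFinite (α : Ordinal.{u}) (S : Set Ordinal.{u}) (hS : S.Finite) : Record α where
  bit ξ := if ξ.1 ∈ S then 1 else 0
  eventually_zero l hl hlim := by
    refine ⟨(hS.toFinset.filter (· < l)).sup succ, ?_, fun β hβ h => if_neg fun hS' => ?_⟩
    · rw [Finset.sup_lt_iff hlim.bot_lt]
      exact fun β hβ => hlim.succ_lt (Finset.mem_filter.1 hβ).2
    · have : succ β ≤ (hS.toFinset.filter (· < l)).sup succ :=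
        Finset.le_sup (f := succ) (by simp [hS', hβ])
      exact (lt_succ β).not_ge (this.trans h)

theorem Record.mem_support_ofFinite {S : Set Ordinal.{u}} {hS : S.Finite} {β : Ordinal.{u}} :
    β ∈ (Record.ofFinite α S hS).support ↔ β < α ∧ β ∈ S := by
  simp [Record.support, Record.ofFinite]

theorem Record.lastZero_eq_add_one (r : Record α) {l γ : Ordinal.{u}} (hl : l ≤ α)
    (hlim : IsSuccLimit l) (hγl : γ < l) (hγ : γ ∈ r.support)
    (hmax : ∀ β ∈ r.support, β < l → β ≤ γ) : r.lastZero l hl = γ + 1 := by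
  have hγ1 : r.bit ⟨γ, hγl.trans_le hl⟩ = 1 := (r.mem_support_iff _).1 hγ
  refine IsLeast.csInf_eq ⟨⟨hlim.succ_lt hγl, fun β hβ h => ?_⟩, fun o ho => ?_⟩
  · rw [← fin_two_ne_one_iff, ne_eq, ← r.mem_support_iff]
    exact fun h1 => (succ_le_iff.1 h).not_ge (hmax β h1 hβ)
  · refine succ_le_of_lt (lt_of_not_ge fun h => ?_)
    rw [ho.2 γ hγl h] at hγ1
    exact absurd hγ1 (by decide)

/-! ### Signals -/

/-- The facts about the coin and player `j` of which the other player may be informed, indexed by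
ordinals: at `0`, that the coin shows heads; at `β + 1`, that `w_j(β) = 1`; at a limit ordinal `l`,
that the `l`-parity of `w_j` is even. -/
def W.signal (w : W α) (j : Player) (c : Ordinal.{u}) : Prop :=
  (c = 0 ∧ w.coin = .h) ∨ (∃ β ∈ (w.record j).support, c = β + 1) ∨
    ∃ h : c < α, IsSuccLimit c ∧ (w.record j).par c h.le = .even

theorem W.signal_zero (w : W α) (j : Player) : w.signal j 0 ↔ w.coin = .h := by
  have h1 : ∀ β : Ordinal.{u}, 0 ≠ β + 1 := fun β => (succ_ne_bot β).symm
  have h2 : ¬ IsSuccLimit (0 : Ordinal.{u}) := not_isSuccLimit_bot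
  simp [W.signal, h1, h2]

theorem W.signal_add_one (w : W α) (j : Player) (β : Ordinal.{u}) :
    w.signal j (β + 1) ↔ β ∈ (w.record j).support := by
  have h1 : β + 1 ≠ 0 := succ_ne_bot β
  have h2 : ¬ IsSuccLimit (β + 1) := not_isSuccLimit_succ β
  have h3 : ∀ γ : Ordinal.{u}, β + 1 = γ + 1 ↔ β = γ := fun γ => succ_eq_succ_iff
  simp [W.signal, h1, h2, h3]

theorem W.signal_limit (w : W α) (j : Player) {l : Ordinal.{u}} (hlim : IsSuccLimit l)
    (hl : l < α) : w.signal j l ↔ (w.record j).par l hl.le = .even := by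
  have h1 : l ≠ 0 := hlim.ne_bot
  have h2 : ∀ β : Ordinal.{u}, l ≠ β + 1 := by
    rintro β rfl
    exact not_isSuccLimit_succ β hlim
  simp [W.signal, h1, h2, hlim, hl]

theorem coin_eq_iff (c d : Coin) : c = d ↔ (c = .h ↔ d = .h) := by
  cases c <;> cases d <;> simp

theorem parity_eq_iff (p q : Parity) : p = q ↔ (p = .even ↔ q = .even) := by
  cases p <;> cases q <;> simp

theorem W.coin_eq_iff_signal (v w : W α) (j : Player) :
    v.coin = w.coin ↔ (v.signal j 0 ↔ w.signal j 0) := by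
  rw [coin_eq_iff, v.signal_zero, w.signal_zero]

theorem W.bit_eq_iff_signal (v w : W α) (j : Player) {β : Ordinal.{u}} (hβ : β < α) :
    (v.record j).bit ⟨β, hβ⟩ = (w.record j).bit ⟨β, hβ⟩ ↔
      (v.signal j (β + 1) ↔ w.signal j (β + 1)) := by
  rw [fin_two_eq_iff, v.signal_add_one, w.signal_add_one, Record.mem_support_iff _ hβ,
    Record.mem_support_iff _ hβ]

theorem W.par_eq_iff_signal (v w : W α) (j : Player) {l : Ordinal.{u}} (hlim : IsSuccLimit l)
    (hl : l < α) : (v.record j).par l hl.le = (w.record j).par l hl.le ↔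
      (v.signal j l ↔ w.signal j l) := by
  rw [parity_eq_iff, v.signal_limit j hlim hl, w.signal_limit j hlim hl]

/-- The three clauses in the definition of a cell say together that the signals of which the player
is informed agree. -/
theorem mem_cell_iff_signal (i : Player) (v w : W α) :
    v ∈ cell i w ↔ v.record i = w.record i ∧
      ∀ c ∈ (w.record i).support, (v.signal i.other c ↔ w.signal i.other c) := by
  refine and_congr_right fun _ => ⟨fun ⟨h0, h1, h2⟩ c hc => ?_, fun h => ⟨?_, ?_, ?_⟩⟩
  · obtain ⟨hcα, hc⟩ := hc
    rcases Ordinal.zero_or_succ_or_isSuccLimit c with rfl | ⟨β, rfl⟩ | hlim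
    · exact (v.coin_eq_iff_signal w _).1 (h0 hcα hc)
    · exact (v.bit_eq_iff_signal w _ _).1 (h1 β hcα hc)
    · exact (v.par_eq_iff_signal w _ hlim hcα).1 (h2 c hcα hlim hc)
  · exact fun h0 hc => (v.coin_eq_iff_signal w _).2 (h 0 ⟨h0, hc⟩)
  · exact fun β hβ hc => (v.bit_eq_iff_signal w _ _).2 (h (β + 1) ⟨hβ, hc⟩)
  · exact fun l hl hlim hc => (v.par_eq_iff_signal w _ hlim hl).2 (h l ⟨hl, hc⟩)

/-! ### Realizing finitely many prescribed signals -/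

/-- The position below the limit ordinal `l` of a `1`, beyond all elements of `G` below `l`, chosen
so that its successor is even if and only if `x l` holds. -/
def marker (G : Finset Ordinal.{u}) (x : Ordinal.{u} → Prop) (l : Ordinal.{u}) : Ordinal.{u} :=
  if IsEvenOrdinal ((G.filter (· < l)).sup id + 1) ↔ x l then (G.filter (· < l)).sup id
  else (G.filter (· < l)).sup id + 1

theorem marker_lt (G : Finset Ordinal.{u}) (x : Ordinal.{u} → Prop) {l : Ordinal.{u}}
    (hlim : IsSuccLimit l) : marker G x l < l := by
  have h : (G.filter (· < l)).sup id < l := by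
    rw [Finset.sup_lt_iff hlim.bot_lt]
    exact fun c hc => (Finset.mem_filter.1 hc).2
  unfold marker
  split_ifs
  · exact h
  · exact hlim.succ_lt h

theorem le_marker {G : Finset Ordinal.{u}} (x : Ordinal.{u} → Prop) {c l : Ordinal.{u}}
    (hc : c ∈ G) (hcl : c < l) : c ≤ marker G x l := by
  have h : c ≤ (G.filter (· < l)).sup id :=
    Finset.le_sup (f := id) (Finset.mem_filter.2 ⟨hc, hcl⟩)
  unfold marker
  split_ifs
  · exact h
  · exact h.trans (le_succ _)

theorem isEvenOrdinal_marker_add_one (G : Finset Ordinal.{u}) (x : Ordinal.{u} → Prop)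
    (l : Ordinal.{u}) : IsEvenOrdinal (marker G x l + 1) ↔ x l := by
  unfold marker
  split_ifs with h
  · exact h
  · rw [isEvenOrdinal_add_one_iff]
    tauto

theorem marker_congr {G G' : Finset Ordinal.{u}} {x x' : Ordinal.{u} → Prop} {l : Ordinal.{u}}
    (hG : ∀ c < l, (c ∈ G ↔ c ∈ G')) (hx : x l ↔ x' l) : marker G x l = marker G' x' l := by
  have h : G.filter (· < l) = G'.filter (· < l) := by
    ext c
    simp only [Finset.mem_filter]
    exact and_congr_left (hG c)
  simp only [marker, h, hx]

/-- The support of a record that realizes the signals `x` at all elements of `G`. -/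
def realization (G : Finset Ordinal.{u}) (x : Ordinal.{u} → Prop) : Set Ordinal.{u} :=
  {β | (β + 1 ∈ G ∧ x (β + 1)) ∨ ∃ l ∈ G, IsSuccLimit l ∧ β = marker G x l}

theorem finite_realization (G : Finset Ordinal.{u}) (x : Ordinal.{u} → Prop) :
    (realization G x).Finite := by
  refine Set.Finite.subset (((G.finite_toSet).preimage
    (f := succ) succ_injective.injOn).union ((G.finite_toSet).image (marker G x))) ?_
  rintro β (⟨h, -⟩ | ⟨l, hl, -, rfl⟩)
  · exact .inl h
  · exact .inr ⟨l, hl, rfl⟩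

theorem mem_realization_of_add_one_mem {G : Finset Ordinal.{u}} (x : Ordinal.{u} → Prop)
    {β : Ordinal.{u}} (hβ : β + 1 ∈ G) : β ∈ realization G x ↔ x (β + 1) := by
  constructor
  · rintro (⟨-, h⟩ | ⟨l, -, hlim, rfl⟩)
    · exact h
    · exact absurd (le_marker x hβ (hlim.succ_lt (marker_lt G x hlim))) (lt_succ _).not_ge
  · exact fun h => .inl ⟨hβ, h⟩

/-- The last element of the realization below a limit ordinal `l ∈ G` is the marker of `l`. -/
theorem le_marker_of_mem_realization {G : Finset Ordinal.{u}} {x : Ordinal.{u} → Prop}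
    {β l : Ordinal.{u}} (hl : l ∈ G) (hlim : IsSuccLimit l) (hβ : β ∈ realization G x)
    (hβl : β < l) : β ≤ marker G x l := by
  rcases hβ with ⟨hβ, -⟩ | ⟨m, hm, hmlim, rfl⟩
  · exact (le_succ β).trans (le_marker x hβ (hlim.succ_lt hβl))
  · rcases lt_trichotomy m l with h | rfl | h
    · exact (marker_lt G x hmlim).le.trans (le_marker x hm h)
    · exact le_rfl
    · exact absurd (le_marker x hl h) hβl.not_ge

theorem par_ofFinite_realization {G : Finset Ordinal.{u}} (x : Ordinal.{u} → Prop)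
    {l : Ordinal.{u}} (hl : l ∈ G) (hlim : IsSuccLimit l) (hlα : l ≤ α) :
    (Record.ofFinite α _ (finite_realization G x)).par l hlα = .even ↔ x l := by
  rw [Record.par, Record.lastZero_eq_add_one _ hlα hlim (marker_lt G x hlim)
    (Record.mem_support_ofFinite.2 ⟨(marker_lt G x hlim).trans_le hlα, .inr ⟨l, hl, hlim, rfl⟩⟩)
    (fun β hβ => le_marker_of_mem_realization hl hlim (Record.mem_support_ofFinite.1 hβ).2),
    ordinalParity_eq_even_iff, isEvenOrdinal_marker_add_one]

/-- Below an element `β` of `G`, the realization depends only on the data up to `β`: the markers of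
the limit ordinals above `β` are at least `β`. -/
theorem mem_realization_congr {G G' : Finset Ordinal.{u}} {x x' : Ordinal.{u} → Prop}
    {β ξ : Ordinal.{u}} (hβ : β ∈ G) (hG : ∀ c ≤ β, (c ∈ G ↔ c ∈ G'))
    (hx : ∀ c ≤ β, (x c ↔ x' c)) (hξ : ξ < β) (h : ξ ∈ realization G x) :
    ξ ∈ realization G' x' := by
  rcases h with ⟨h1, h2⟩ | ⟨l, hl, hlim, rfl⟩
  · have hle : ξ + 1 ≤ β := succ_le_of_lt hξ
    exact .inl ⟨(hG _ hle).1 h1, (hx _ hle).1 h2⟩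
  · have hle : l ≤ β := le_of_not_gt fun h => (le_marker x hβ h).not_gt hξ
    exact .inr ⟨l, (hG l hle).1 hl, hlim,
      marker_congr (fun c hc => hG c (hc.le.trans hle)) (hx l hle)⟩

/-! ### Completions of the information of a player -/

/-- The signals known to player `i` at `w`, with the unknown ones replaced by `y`. -/
def W.target (w : W α) (i : Player) (y : Prop) (c : Ordinal.{u}) : Prop :=
  if c ∈ (w.record i).support then w.signal i.other c else y

/-- The indices in `F` together with those of the signals known to player `i` at `w`. -/
def W.indices (w : W α) (i : Player) (F : Finset Ordinal.{u}) : Finset Ordinal.{u} :=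
  F ∪ (w.record i).finite_support.toFinset

theorem W.mem_indices {w : W α} {i : Player} {F : Finset Ordinal.{u}} {c : Ordinal.{u}} :
    c ∈ w.indices i F ↔ c ∈ F ∨ c ∈ (w.record i).support := by
  simp [W.indices]

/-- The state in which player `i` has the same record as at `w`, the signals known to `i` are as at
`w`, and the other signals indexed by `F` are equal to `y`. -/
def W.completion (w : W α) (i : Player) (y : Prop) (F : Finset Ordinal.{u}) : W α where
  coin := if w.target i y 0 then .h else .t
  record k := if k = i then w.record i else
    .ofFinite α _ (finite_realization (w.indices i F) (w.target i y))

theorem Player.other_ne (i : Player) : i.other ≠ i := by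
  cases i <;> simp [Player.other]

theorem W.record_completion_self (w : W α) (i : Player) (y : Prop) (F : Finset Ordinal.{u}) :
    (w.completion i y F).record i = w.record i :=
  if_pos rfl

theorem W.record_completion_of_ne (w : W α) {i k : Player} (hk : k ≠ i) (y : Prop)
    (F : Finset Ordinal.{u}) : (w.completion i y F).record k =
      .ofFinite α _ (finite_realization (w.indices i F) (w.target i y)) :=
  if_neg hk

theorem W.signal_completion (w : W α) (i : Player) (y : Prop) {F : Finset Ordinal.{u}}
    {c : Ordinal.{u}} (hcα : c < α) (hc : c ∈ w.indices i F) :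
    (w.completion i y F).signal i.other c ↔ w.target i y c := by
  rcases Ordinal.zero_or_succ_or_isSuccLimit c with rfl | ⟨β, rfl⟩ | hlim
  · rw [W.signal_zero]
    by_cases h : w.target i y 0 <;> simp [W.completion, h]
  · have hβ : β < α := (lt_succ β).trans hcα
    refine (W.signal_add_one _ _ _).trans ?_
    rw [W.record_completion_of_ne _ i.other_ne, Record.mem_support_ofFinite, and_iff_right hβ]
    exact mem_realization_of_add_one_mem _ hc
  · rw [W.signal_limit _ _ hlim hcα, W.record_completion_of_ne _ i.other_ne]
    exact par_ofFinite_realization _ hc hlim hcα.le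

theorem W.completion_mem_cell (w : W α) (i : Player) (y : Prop) (F : Finset Ordinal.{u}) :
    w.completion i y F ∈ cell i w := by
  refine (mem_cell_iff_signal _ _ _).2 ⟨w.record_completion_self i y F, fun c hc => ?_⟩
  rw [w.signal_completion i y hc.1 (W.mem_indices.2 (.inr hc)), W.target, if_pos hc]

theorem W.completion_eq_of_mem_cell {v w : W α} {i : Player} (h : v ∈ cell i w) (y : Prop)
    (F : Finset Ordinal.{u}) : v.completion i y F = w.completion i y F := by
  obtain ⟨h1, h2⟩ := (mem_cell_iff_signal _ _ _).1 h
  have hx : v.target i y = w.target i y := by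
    funext c
    by_cases hc : c ∈ (w.record i).support
    · simp [W.target, h1, hc, h2 c hc]
    · simp [W.target, h1, hc]
  simp only [W.completion, W.indices, hx, h1]

theorem W.signal_congr_of_restrict_eq {v w : W α} {β : Ordinal.{u}} (hβ : β ≤ α)
    (h : v.restrict β hβ = w.restrict β hβ) (j : Player) {c : Ordinal.{u}} (hc : c < β) :
    v.signal j c ↔ w.signal j c := by
  have hs : ∀ u : W α, u.signal j c ↔ (u.restrict β hβ).signal j c := by
    intro u
    rcases Ordinal.zero_or_succ_or_isSuccLimit c with rfl | ⟨γ, rfl⟩ | hlim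
    · rw [W.signal_zero, W.signal_zero]
      rfl
    · refine (W.signal_add_one _ _ _).trans (Iff.trans ?_ (W.signal_add_one _ _ _).symm)
      exact ((Record.mem_support_restrict _ hβ).trans
        (and_iff_right ((lt_succ γ).trans hc))).symm
    · rw [W.signal_limit _ _ hlim (hc.trans_le hβ), W.signal_limit _ _ hlim hc]
      rfl
  rw [hs v, hs w, h]

theorem W.mem_support_congr_of_restrict_eq {v w : W α} {β : Ordinal.{u}} (hβ : β ≤ α)
    (h : v.restrict β hβ = w.restrict β hβ) (i : Player) {c : Ordinal.{u}} (hc : c < β) :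
    c ∈ (v.record i).support ↔ c ∈ (w.record i).support := by
  have hs : ∀ u : W α, c ∈ (u.record i).support ↔ c ∈ ((u.restrict β hβ).record i).support :=
    fun u => ((Record.mem_support_restrict _ hβ).trans (and_iff_right hc)).symm
  rw [hs v, hs w, h]

/-- Once `β ∈ F`, the restriction of the completion to `β` depends only on the state below any
`γ > β`. -/
theorem W.restrict_completion_congr {v w : W α} {β γ : Ordinal.{u}} (hβ : β < γ) (hγ : γ ≤ α)
    (h : v.restrict γ hγ = w.restrict γ hγ) (i : Player) (y : Prop) {F : Finset Ordinal.{u}}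
    (hF : β ∈ F) : (v.completion i y F).restrict β (hβ.le.trans hγ) =
      (w.completion i y F).restrict β (hβ.le.trans hγ) := by
  have hs : ∀ c ≤ β, (c ∈ (v.record i).support ↔ c ∈ (w.record i).support) := fun c hc =>
    W.mem_support_congr_of_restrict_eq hγ h i (hc.trans_lt hβ)
  have hx : ∀ c ≤ β, (v.target i y c ↔ w.target i y c) := fun c hc => by
    simp only [W.target, hs c hc, W.signal_congr_of_restrict_eq hγ h i.other (hc.trans_lt hβ)]
  have hG : ∀ c ≤ β, (c ∈ v.indices i F ↔ c ∈ w.indices i F) := fun c hc => by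
    rw [W.mem_indices, W.mem_indices, hs c hc]
  refine W.ext ?_ (funext fun k => Record.ext_support (Set.ext fun ξ => ?_))
  · simp only [W.restrict, W.completion, hx 0 (zero_le (a := β))]
  · refine (Record.mem_support_restrict _ (hβ.le.trans hγ)).trans (Iff.trans
      (and_congr_right fun hξ => ?_) (Record.mem_support_restrict _ (hβ.le.trans hγ)).symm)
    by_cases hk : k = i
    · subst hk
      rw [W.record_completion_self, W.record_completion_self]
      exact hs ξ hξ.le
    · rw [W.record_completion_of_ne _ hk, W.record_completion_of_ne _ hk,
        Record.mem_support_ofFinite, Record.mem_support_ofFinite]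
      exact and_congr_right fun _ =>
        ⟨mem_realization_congr (W.mem_indices.2 (.inl hF)) hG hx hξ,
        mem_realization_congr (W.mem_indices.2 (.inl hF)) (fun c hc => (hG c hc).symm)
          (fun c hc => (hx c hc).symm) hξ⟩

/-! ### The beliefs of a player -/

/-- The mean of the two-valued measures given by two ultrafilters. -/
def FinAddProb.mean {M : Type*} (U V : Ultrafilter M) : FinAddProb M where
  toFun E := ((if E ∈ U then 1 else 0) + (if E ∈ V then 1 else 0)) / 2
  nonneg E := by positivity
  union_add E F h := by
    have key : ∀ U : Ultrafilter M, (if E ∪ F ∈ U then (1 : ℝ) else 0) =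
        (if E ∈ U then 1 else 0) + (if F ∈ U then 1 else 0) := by
      intro U
      have hne : ¬ (E ∈ U ∧ F ∈ U) := fun ⟨h1, h2⟩ => by
        have := U.inter_mem_iff.2 ⟨h1, h2⟩
        rw [h.inter_eq] at this
        exact U.empty_notMem this
      by_cases h1 : E ∈ U <;> by_cases h2 : F ∈ U <;> simp_all [Ultrafilter.union_mem_iff]
    rw [key U, key V]
    ring
  univ_eq_one := by
    have h : ∀ U : Ultrafilter M, Set.univ ∈ U := fun U => univ_mem (f := (U : Filter M))
    simp [h]

/-- An ultrafilter on the finite sets of ordinals that contains `{F | c ∈ F}` for every `c`. -/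
def finsetUltrafilter : Ultrafilter (Finset Ordinal.{u}) :=
  Ultrafilter.of atTop

theorem eventually_mem_finsetUltrafilter (c : Ordinal.{u}) :
    ∀ᶠ F in (finsetUltrafilter : Filter (Finset Ordinal.{u})), c ∈ F :=
  Ultrafilter.of_le atTop ((eventually_ge_atTop {c}).mono fun _ h =>
    h (Finset.mem_singleton_self c))

/-- The belief of player `i` at `w`: a fair coin decides whether all unknown signals are true or all
are false. -/
def W.belief (i : Player) (w : W α) : FinAddProb (W α) :=
  .mean (finsetUltrafilter.map (w.completion i True))
    (finsetUltrafilter.map (w.completion i False))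

theorem W.belief_apply (i : Player) (w : W α) (E : Set (W α)) :
    W.belief i w E = ((if ∀ᶠ F in finsetUltrafilter, w.completion i True F ∈ E then 1 else 0) +
      (if ∀ᶠ F in finsetUltrafilter, w.completion i False F ∈ E then 1 else 0)) / 2 :=
  rfl

theorem W.belief_eq_of_mem_cell {i : Player} {v w : W α} (h : v ∈ cell i w) :
    W.belief i v = W.belief i w := by
  have hc : ∀ y, v.completion i y = w.completion i y := fun y =>
    funext fun F => W.completion_eq_of_mem_cell h y F
  simp only [W.belief, hc]

theorem W.belief_cell (i : Player) (w : W α) : W.belief i w (cell i w) = 1 := by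
  simp [W.belief_apply, W.completion_mem_cell]

theorem W.belief_signal (i : Player) (w : W α) {c : Ordinal.{u}} (hc : c < α) :
    W.belief i w {u | u.signal i.other c ↔ w.signal i.other c} =
      if (w.record i).bit ⟨c, hc⟩ = 1 then 1 else 1 / 2 := by
  have key : ∀ y, (∀ᶠ F in finsetUltrafilter,
      w.completion i y F ∈ {u : W α | u.signal i.other c ↔ w.signal i.other c}) ↔
        (w.target i y c ↔ w.signal i.other c) := by
    intro y
    refine (eventually_congr ((eventually_mem_finsetUltrafilter c).mono fun F hF => by
    rw [Set.mem_ofPred_eq, w.signal_completion i y hc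
      (W.mem_indices.2 (.inl hF))])).trans eventually_const
  rw [W.belief_apply]
  simp only [key, W.target, (w.record i).mem_support_iff hc]
  by_cases h : (w.record i).bit ⟨c, hc⟩ = 1 <;> by_cases hs : w.signal i.other c <;> simp [h, hs]

theorem W.belief_local (i : Player) {v w : W α} {β γ : Ordinal.{u}} (hβ : β < γ) (hγ : γ ≤ α)
    (h : v.restrict γ hγ = w.restrict γ hγ) (E : Set (W β)) :
    W.belief i v ((fun x : W α => x.restrict β (hβ.le.trans hγ)) ⁻¹' E) =
      W.belief i w ((fun x : W α => x.restrict β (hβ.le.trans hγ)) ⁻¹' E) := by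
  have key : ∀ y, (∀ᶠ F in finsetUltrafilter,
      v.completion i y F ∈ (fun x : W α => x.restrict β (hβ.le.trans hγ)) ⁻¹' E) ↔
      ∀ᶠ F in finsetUltrafilter,
        w.completion i y F ∈ (fun x : W α => x.restrict β (hβ.le.trans hγ)) ⁻¹' E := by
    intro y
    refine eventually_congr ((eventually_mem_finsetUltrafilter β).mono fun F hF => ?_)
    rw [Set.mem_preimage, Set.mem_preimage, W.restrict_completion_congr hβ hγ h i y hF]
  simp only [W.belief_apply, key]

end CoinRecords

end

theorem theorem2 (κ : Cardinal.{u}) (hκ : κ.IsRegular) (i : Player) :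
    ∃ T : W κ.ord → FinAddProb (W κ.ord),
      -- (a)
      (∀ w, ∀ v ∈ cell i w, T v = T w) ∧
      -- (b)
      (∀ w, T w (cell i w) = 1) ∧
      -- (c)
      (∀ w, T w (coinEvent κ.ord w.coin) =
        if (w.record i).bit ⟨0, ord_pos hκ⟩ = 1 then 1 else 1 / 2) ∧
      -- (d)
      (∀ w, ∀ (β : Ordinal.{u}) (hβ : β < κ.ord),
        T w (bitEvent i.other β hβ ((w.record i.other).bit ⟨β, hβ⟩)) =
          if (w.record i).bit ⟨β + 1, add_one_lt_ord hκ hβ⟩ = 1 then 1 else 1 / 2) ∧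
      -- (e)
      (∀ w, ∀ (l : Ordinal.{u}) (hl : l < κ.ord), Order.IsSuccLimit l →
        T w (parEvent i.other l hl.le ((w.record i.other).par l hl.le)) =
          if (w.record i).bit ⟨l, hl⟩ = 1 then 1 else 1 / 2) ∧
      -- (f)
      (∀ (α β : Ordinal.{u}) (hβ : β < α) (hα : α < κ.ord) (v w : W κ.ord),
        v.restrict α hα.le = w.restrict α hα.le → ∀ E : Set (W β),
          T v ((fun x : W κ.ord => x.restrict β (hβ.trans hα).le) ⁻¹' E) =
            T w ((fun x : W κ.ord => x.restrict β (hβ.trans hα).le) ⁻¹' E)) := by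
  refine ⟨W.belief i, fun w v hv => W.belief_eq_of_mem_cell hv, W.belief_cell i, fun w => ?_,
    fun w β hβ => ?_, fun w l hl hlim => ?_,
    fun α β hβ hα v w h E => W.belief_local i hβ hα.le h E⟩
  · rw [← W.belief_signal i w (ord_pos hκ)]
    congr 1
    exact Set.ext fun u => u.coin_eq_iff_signal w _
  · rw [← W.belief_signal i w (add_one_lt_ord hκ hβ)]
    congr 1
    exact Set.ext fun u => u.bit_eq_iff_signal w _ hβ
  · rw [← W.belief_signal i w hl]
    congr 1
    exact Set.ext fun u => u.par_eq_iff_signal w _ hlim hl
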